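/- Let $d\in\mathbb N_0$, $s>0$, $T>0$. Let $H^s(\mathbb R^d)=\{u\in L^2(\mathbb R^d;\mathbb C): (-\Delta)^{s/2}u\in L^2\}$ with the norm $\|u\|_{H^s}=\|u\|_{L^2}+\|(-\Delta)^{s/2}u\|_{L^2}$, where $(-\Delta)^{a}$ is the Fourier multiplier with symbol $|\xi|^{2a}$. For a real function $q\in L^\infty(\mathbb R^d)$ and $v_0\in H^s$, a solution of $$ i\,\partial_t v+(-\Delta)^s v+q\,v=0 \ \text{ on } [0,T]\times\mathbb R^d,\qquad v(0)=v_0, \tag{1}$$ is a function $v\in C([0,T];H^s)$ with $v(0)=v_0$ that satisfies the equation in $H^{-s}$ for every $t\in[0,T]$: for all $w\in H^s$ the function $t\mapsto\langle v(t),w\rangle_{L^2}$ is differentiable on $[0,T]$ (one-sidedly at the end points) and $i\frac{d}{dt}\langle v(t),w\rangle+\langle(-\Delta)^{s/2}v(t),(-\Delta)^{s/2}w\rangle+\langle q\,v(t),w\rangle=0$. A net $(p_\varepsilon)_{\varepsilon\in(0,1]}$ in $L^\infty$ is $L^\infty$-moderate if $\|p_\varepsilon\|_{L^\infty}\le C\varepsilon^{-N}$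 for some $C>0$, $N\in\mathbb N_0$ and all $\varepsilon\in(0,1]$. A net $(u_{0,\varepsilon})$ in $H^s$ is $H^s$-moderate if $\|u_{0,\varepsilon}\|_{H^s}\le C_0\varepsilon^{-N_0}$ for some $C_0>0$, $N_0\in\mathbb N_0$ and all $\varepsilon\in(0,1]$. A net $(u_\varepsilon)$ in $C([0,T];H^s)$ is $H^s$-moderate if $\|u_\varepsilon(t)\|_{H^s}\le c\,\varepsilon^{-M}$ for some $c>0$, $M\in\mathbb N_0$, all $\varepsilon\in(0,1]$ and all $t\in[0,T]$. A very weak solution of order $s$ for regularisations $(p_\varepsilon)$, $(u_{0,\varepsilon})$ is an $H^s$-moderate net $(u_\varepsilon)$ in $C([0,T];H^s)$ such that, for every $\varepsilon\in(0,1]$, $u_\varepsilon$ solves (1) with $q=p_\varepsilon$, $v_0=u_{0,\varepsilon}$; here $(p_\varepsilon)$ is required to be $L^\infty$-moderate and $(u_{0,\varepsilon})$ to be $H^s$-moderate. **Theorem (Existence).** (a) Let $(p_\varepsilon)_{\varepsilon\in(0,1]}$ be an $L^\infty$-moderate net of non-negative functions and $(u_{0,\varepsilon})_{\varepsilon\in(0,1]}$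 an $H^s$-moderate net (regularisations of a potential $p\ge0$ and of data $u_0$, which need not be distributions; e.g. $p=\delta$ or $p=\delta^2$, regularised as $\psi_\varepsilon$ or $\psi_\varepsilon^2$ with $\psi_\varepsilon$ as in (b)). Then there is a very weak solution for these regularisations, and every net $(u_\varepsilon)$ of solutions $u_\varepsilon\in C([0,T];H^s)$ of the regularised problems is $H^s$-moderate, uniformly in $t\in[0,T]$. (b) Let $p$ be a non-negative distribution and $u_0$ a complex-valued distribution on $\mathbb R^d$. A regularisation of a distribution $P$ is a net $P*\psi_\varepsilon$, $\varepsilon\in(0,1]$, where $\psi_\varepsilon(x)=\varepsilon^{-d}\psi(x/\varepsilon)$ with some $\psi\in C_c^\infty(\mathbb R^d)$, $\psi\ge0$, $\int\psi=1$. If $p$ has an $L^\infty$-moderate regularisation and $u_0$ has an $H^s$-moderate regularisation, then the Cauchy problem $i u_t+(-\Delta)^s u+p\,u=0$, $u(0)=u_0$ has a very weak solution, i.e. there is a net $(u_\varepsilon)$ that is a very weak solution of order $s$ for some $L^\infty$-moderate regularisation of $p$ and some $H^s$-moderate regularisation of $u_0$. -/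

import Mathlib

open MeasureTheory Set Filter Topology
open scoped ENNReal FourierTransform Distributions InnerProductSpace

noncomputable section

namespace FracSchrodinger

/-- The space `ℝᵈ` with its Euclidean norm. -/
abbrev Space (d : ℕ) : Type := EuclideanSpace ℝ (Fin d)

/-- The complex Hilbert space `L²(ℝᵈ)`. -/
abbrev L2 (d : ℕ) : Type := Lp ℂ 2 (volume : Measure (Space d))

/-- The space `L^∞(ℝᵈ)` of real-valued functions. -/
abbrev Linfty (d : ℕ) : Type := Lp ℝ ∞ (volume : Measure (Space d))

/-- The parameter set `(0, 1]` of the regularisations. -/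
abbrev Eps : Type := Ioc (0 : ℝ) 1

/-! ### The fractional Laplacian and the Sobolev space `H^s` -/

/-- The function `ξ ↦ (2π|ξ|)^{2a} û(ξ)`. Mathlib's Fourier transform is
`û(ξ) = ∫ e^{-2πi x·ξ} u(x) dx`, so that `-Δ` has the symbol `(2π|ξ|)²`. -/
def fracSymbolMul {d : ℕ} (a : ℝ) (u : L2 d) : Space d → ℂ :=
  fun ξ => (((2 * Real.pi * ‖ξ‖) ^ (2 * a) : ℝ) : ℂ) * (𝓕 u : L2 d) ξ

/-- `u ∈ L²` and `(-Δ)^a u ∈ L²`. -/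
def MemFracDomain {d : ℕ} (a : ℝ) (u : L2 d) : Prop :=
  MemLp (fracSymbolMul a u) 2 (volume : Measure (Space d))

open Classical in
/-- The fractional Laplacian `(-Δ)^a u ∈ L²` of a function `u` in its domain
(and `0` for the other `u`). -/
def fracLaplacian {d : ℕ} (a : ℝ) (u : L2 d) : L2 d :=
  if h : MemFracDomain a u then (𝓕⁻ (h.toLp (fracSymbolMul a u) : L2 d) : L2 d) else 0

/-- `u ∈ H^s(ℝᵈ)`, that is, `u ∈ L²` and `(-Δ)^{s/2} u ∈ L²`. -/
def MemHs {d : ℕ} (s : ℝ) (u : L2 d) : Prop := MemFracDomain (s / 2) u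

/-- The norm `‖u‖_{H^s} = ‖u‖_{L²} + ‖(-Δ)^{s/2} u‖_{L²}` of `u ∈ H^s(ℝᵈ)`. -/
def hsNorm {d : ℕ} (s : ℝ) (u : L2 d) : ℝ := ‖u‖ + ‖fracLaplacian (s / 2) u‖

/-- `u ∈ C([0,T]; H^s(ℝᵈ))`. -/
def ContinuousHs {d : ℕ} (s T : ℝ) (u : ℝ → L2 d) : Prop :=
  (∀ t ∈ Icc (0 : ℝ) T, MemHs s (u t)) ∧
    ∀ t ∈ Icc (0 : ℝ) T,
      Tendsto (fun τ => hsNorm s (u τ - u t)) (𝓝[Icc (0 : ℝ) T] t) (𝓝 0)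

/-! ### The Cauchy problem with a bounded potential -/

/-- `u ∈ C([0,T]; H^s)` solves `i ∂ₜu + (-Δ)^s u + p u = 0` on `[0,T] × ℝᵈ`, `u(0) = u₀`, where
`p ∈ L^∞`. For `u(t) ∈ H^s` the equation is one in `H^{-s}`, the antidual of `H^s`: it is tested
with all `v ∈ H^s`, where `⟨v, (-Δ)^s u⟩ = ⟨(-Δ)^{s/2} v, (-Δ)^{s/2} u⟩_{L²}`. At the end points of
`[0,T]` the time derivative is one-sided. -/
structure IsSolution {d : ℕ} (s T : ℝ) (p : Linfty d) (u₀ : L2 d) (u : ℝ → L2 d) : Prop where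
  continuousHs : ContinuousHs s T u
  initial : u 0 = u₀
  equation : ∀ t ∈ Icc (0 : ℝ) T, ∀ v : L2 d, MemHs s v →
    ∃ D : ℂ, HasDerivWithinAt (fun τ => ⟪v, u τ⟫_ℂ) D (Icc (0 : ℝ) T) t ∧
      Complex.I * D + ⟪fracLaplacian (s / 2) v, fracLaplacian (s / 2) (u t)⟫_ℂ
        + ⟪v, (p • u t : L2 d)⟫_ℂ = 0

/-! ### Moderate nets -/

/-- The net `(g_ε)` is `L^∞`-moderate. -/
def LinftyModerate {d : ℕ} (g : Eps → Linfty d) : Prop :=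
  ∃ (N : ℕ) (c : ℝ), 0 < c ∧ ∀ ε : Eps, ‖g ε‖ ≤ c * (ε : ℝ) ^ (-(N : ℤ))

/-- The net `(f_ε)` of functions in `H^s` is `H^s`-moderate. -/
def HsModerate {d : ℕ} (s : ℝ) (f : Eps → L2 d) : Prop :=
  (∀ ε : Eps, MemHs s (f ε)) ∧
    ∃ (N : ℕ) (c : ℝ), 0 < c ∧ ∀ ε : Eps, hsNorm s (f ε) ≤ c * (ε : ℝ) ^ (-(N : ℤ))

/-- The net `(u_ε)` in `C([0,T]; H^s)` is `H^s`-moderate, uniformly in `t ∈ [0,T]`. -/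
def HsModerateOn {d : ℕ} (s T : ℝ) (u : Eps → ℝ → L2 d) : Prop :=
  (∀ ε : Eps, ContinuousHs s T (u ε)) ∧
    ∃ (N : ℕ) (c : ℝ), 0 < c ∧
      ∀ ε : Eps, ∀ t ∈ Icc (0 : ℝ) T, hsNorm s (u ε t) ≤ c * (ε : ℝ) ^ (-(N : ℤ))

/-! ### Very weak solutions -/

/-- The net `(u_ε)` is a very weak solution of order `s` for the regularisations `(p_ε)` of the
potential and `(u_{0,ε})` of the Cauchy data. -/
structure IsVeryWeakSolutionFor {d : ℕ} (s T : ℝ) (p : Eps → Linfty d) (u₀ : Eps → L2 d)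
    (u : Eps → ℝ → L2 d) : Prop where
  potential_moderate : LinftyModerate p
  data_moderate : HsModerate s u₀
  solves : ∀ ε : Eps, IsSolution s T (p ε) (u₀ ε) (u ε)
  moderate : HsModerateOn s T u

/-! ### Regularisation of distributions by convolution -/

/-- A Friedrichs mollifier: `ψ ∈ C_c^∞(ℝᵈ)`, `ψ ≥ 0`, `∫ ψ = 1`. -/
def IsMollifier {d : ℕ} (ψ : 𝓓((⊤ : TopologicalSpace.Opens (Space d)), ℝ)) : Prop :=
  (∀ x, 0 ≤ ψ x) ∧ ∫ x, ψ x = 1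

/-- The test function `y ↦ ψ_ε(x - y)`, where `ψ_ε(z) = ε^{-d} ψ(z / ε)`. -/
def mollifierAt {d : ℕ} (ψ : 𝓓((⊤ : TopologicalSpace.Opens (Space d)), ℝ)) (ε : Eps)
    (x : Space d) : 𝓓((⊤ : TopologicalSpace.Opens (Space d)), ℝ) where
  toFun := fun y => ((ε : ℝ) ^ d)⁻¹ * ψ ((ε : ℝ)⁻¹ • (x - y))
  contDiff' := by
    have h := ψ.contDiff
    exact contDiff_const.mul
      (h.comp ((contDiff_const.sub contDiff_id).const_smul ((ε : ℝ)⁻¹)))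
  hasCompactSupport' := by
    have hε : ((ε : ℝ)⁻¹) ≠ 0 := inv_ne_zero (ne_of_gt ε.2.1)
    have h : HasCompactSupport (fun y => ψ ((ε : ℝ)⁻¹ • (x - y))) :=
      ψ.hasCompactSupport.comp_homeomorph
        ((Homeomorph.subLeft x).trans (Homeomorph.smulOfNeZero _ hε))
    exact h.mul_left
  tsupport_subset' := fun _ _ => trivial

/-- The convolution `(P * ψ_ε)(x)` of a distribution `P` with `ψ_ε`. -/
def mollify {d : ℕ} {F : Type} [NormedAddCommGroup F] [NormedSpace ℝ F]
    (P : 𝓓'((⊤ : TopologicalSpace.Opens (Space d)), F))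
    (ψ : 𝓓((⊤ : TopologicalSpace.Opens (Space d)), ℝ)) (ε : Eps) (x : Space d) : F :=
  P (mollifierAt ψ ε x)

/-- The net `(p_ε)` in `L^q` is the regularisation `p_ε = P * ψ_ε` of the distribution `P`
with some Friedrichs mollifier `ψ`. -/
def IsRegularisation {d : ℕ} {F : Type} [NormedAddCommGroup F] [NormedSpace ℝ F] {q : ℝ≥0∞}
    (P : 𝓓'((⊤ : TopologicalSpace.Opens (Space d)), F))
    (p : Eps → Lp F q (volume : Measure (Space d))) : Prop :=
  ∃ ψ : 𝓓((⊤ : TopologicalSpace.Opens (Space d)), ℝ), IsMollifier ψ ∧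
    ∀ ε : Eps, (p ε : Space d → F) =ᵐ[volume] mollify P ψ ε

/-- A real distribution `P` is non-negative. -/
def DistribNonneg {d : ℕ} (P : 𝓓'((⊤ : TopologicalSpace.Opens (Space d)), ℝ)) : Prop :=
  ∀ φ : 𝓓((⊤ : TopologicalSpace.Opens (Space d)), ℝ), (∀ x, 0 ≤ φ x) → 0 ≤ P φ

/-- The net `(u_ε)` is a very weak solution of order `s` of the Cauchy problem
`i ∂ₜu + (-Δ)^s u + P u = 0`, `u(0) = U₀` with distributions `P` and `U₀`. -/
def IsVeryWeakSolution {d : ℕ} (s T : ℝ)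
    (P : 𝓓'((⊤ : TopologicalSpace.Opens (Space d)), ℝ))
    (U₀ : 𝓓'((⊤ : TopologicalSpace.Opens (Space d)), ℂ)) (u : Eps → ℝ → L2 d) : Prop :=
  ∃ (p : Eps → Linfty d) (u₀ : Eps → L2 d),
    IsRegularisation P p ∧ IsRegularisation U₀ u₀ ∧ IsVeryWeakSolutionFor s T p u₀ u

end FracSchrodinger

end

/-! Write `A = (-Δ)^s`, let `Q` be multiplication by `p ≥ 0`, and put `J = (1 + A)^{-1/2}`, which
maps `L²` bijectively onto `H^s`. With `u = J f` and test functions `J g`, the equation in `H^{-s}`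
becomes the weak form of `d/dt J² f = i (C f - J² f)`, `C = 1 + J Q J`, where only bounded operators
occur. Since `p ≥ 0`, `C ≥ 1`, so `D = √C` has a bounded inverse `B`. For `h = D f` and the
injective self-adjoint `R = B J² B` one gets `d/dt R h = i (1 - R) h`, formally `h(t) = e^{it(R⁻¹ -
1)} h(0)`.

`exists_flow` builds this group without unbounded operators: `x e^{it(1/x - 1)}` is continuous on
the spectrum of `R`, so `R e^{it(R⁻¹ - 1)}` comes from the continuous functional calculus, and `R`
is divided out on its dense range. `flow_unique` rests on conservation of `‖R h‖`.

Since `‖D f‖² = ‖u‖² + ‖A^{1/2} u‖² + ⟨u, p u⟩`, the bound `‖h(t)‖ ≤ ‖h(0)‖` gives `‖u(t)‖_{H^s} ≤ 2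
(1 + ‖p‖_∞) ‖u₀‖_{H^s}`, and by uniqueness every solution obeys it. The growth in `‖p‖_∞` is
polynomial, so moderate nets yield moderate solutions. For distributions, mollifying with `ψ ≥ 0`
keeps the potential non-negative. -/

namespace FracSchrodinger

/-! ### The unitary group `e^{it(R⁻¹ - 1)}` of an injective self-adjoint operator `R` -/

section AbstractFlow

/-- The function `x ↦ x e^{it(1/x - 1)}` of the real part `x` of a complex number. -/
noncomputable def phase (t : ℝ) (z : ℂ) : ℂ :=
  (z.re : ℂ) * Complex.exp (Complex.I * ((t * (z.re⁻¹ - 1) : ℝ) : ℂ))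

lemma norm_phase (t : ℝ) (z : ℂ) : ‖phase t z‖ = |z.re| := by
  rw [phase, norm_mul, mul_comm Complex.I, Complex.norm_exp_ofReal_mul_I]
  simp

/-- At `re z = 0` the oscillation of the exponential is harmless because the modulus is `|re z|`. -/
lemma continuous_phase (t : ℝ) : Continuous (phase t) := by
  refine continuous_iff_continuousAt.2 fun z => ?_
  by_cases hz : z.re = 0
  · have h0 : phase t z = 0 := by simp [phase, hz]
    rw [ContinuousAt, h0, tendsto_zero_iff_norm_tendsto_zero]
    simp only [norm_phase]
    have : ContinuousAt (fun w : ℂ => |w.re|) z := by fun_prop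
    simpa [ContinuousAt, hz] using this
  · have h1 : ContinuousAt (fun w : ℂ => w.re⁻¹) z :=
      (Complex.continuous_re.continuousAt).inv₀ hz
    unfold phase
    fun_prop

lemma phase_eq_mul (t τ : ℝ) (z : ℂ) : phase τ z = phase t z *
    Complex.exp (Complex.I * (((τ - t) * (z.re⁻¹ - 1) : ℝ) : ℂ)) := by
  unfold phase
  rw [mul_assoc, ← Complex.exp_add]
  push_cast
  ring_nf

/-- The factor `x = re z` absorbs the singularity: `|x| |1/x - 1| = |1 - x|`. On a bounded spectrum
this is a uniform Lipschitz bound in time. -/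
lemma norm_phase_sub_le (t τ : ℝ) (z : ℂ) :
    ‖phase τ z - phase t z‖ ≤ |τ - t| * |1 - z.re| := by
  by_cases hz : z.re = 0
  · simp [phase, hz]
  have h : phase τ z - phase t z = phase t z *
      (Complex.exp (Complex.I * (((τ - t) * (z.re⁻¹ - 1) : ℝ) : ℂ)) - 1) := by
    rw [phase_eq_mul t τ]
    ring
  rw [h, norm_mul, norm_phase]
  calc |z.re| * _ ≤ |z.re| * ‖(τ - t) * (z.re⁻¹ - 1)‖ := by
        gcongr
        exact Real.norm_exp_I_mul_ofReal_sub_one_le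
    _ = |τ - t| * |1 - z.re| := by
        rw [Real.norm_eq_abs, ← abs_mul, ← abs_mul]
        congr 1
        field_simp

lemma norm_exp_I_sub_one_sub_le (x : ℝ) :
    ‖Complex.exp (Complex.I * x) - 1 - Complex.I * x‖ ≤ 2 * x ^ 2 := by
  have hn : ‖Complex.I * (x : ℂ)‖ = |x| := by simp
  rcases le_or_gt |x| 1 with h | h
  · have := Complex.norm_exp_sub_one_sub_id_le (x := Complex.I * x) (by rwa [hn])
    rw [hn, sq_abs] at this
    nlinarith [sq_nonneg x]
  · calc _ ≤ ‖Complex.exp (Complex.I * x) - 1‖ + ‖Complex.I * (x : ℂ)‖ := norm_sub_le _ _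
      _ ≤ |x| + |x| := by
        rw [hn]
        gcongr
        exact Real.norm_exp_I_mul_ofReal_sub_one_le
      _ ≤ 2 * x ^ 2 := by
        rw [← sq_abs]
        nlinarith

/-- A second factor `x` pays for the quadratic remainder, as `x² (1/x - 1)² = (1 - x)²`. Hence `R *
smoothedFlow R` is differentiable in operator norm. -/
lemma norm_phase_taylor_le (t τ : ℝ) (z : ℂ) :
    ‖(z.re : ℂ) * phase τ z - z.re * phase t z
      - (τ - t : ℝ) * (Complex.I * ((1 - z.re) * phase t z))‖ ≤ 2 * (1 - z.re) ^ 2 * (τ - t) ^ 2 := by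
  by_cases hz : z.re = 0
  · simp [phase, hz]
    positivity
  have hz' : (z.re : ℂ) ≠ 0 := by exact_mod_cast hz
  have h : (z.re : ℂ) * phase τ z - z.re * phase t z
      - (τ - t : ℝ) * (Complex.I * ((1 - z.re) * phase t z)) = z.re * phase t z *
      (Complex.exp (Complex.I * (((τ - t) * (z.re⁻¹ - 1) : ℝ) : ℂ)) - 1
        - Complex.I * (((τ - t) * (z.re⁻¹ - 1) : ℝ) : ℂ)) := by
    rw [phase_eq_mul t τ]
    push_cast
    field_simp
  rw [h, norm_mul, norm_mul, norm_phase, Complex.norm_real, Real.norm_eq_abs, abs_mul_abs_self]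
  calc _ ≤ z.re * z.re * (2 * ((τ - t) * (z.re⁻¹ - 1)) ^ 2) := by
        gcongr
        · exact mul_self_nonneg _
        · exact norm_exp_I_sub_one_sub_le _
    _ = 2 * (1 - z.re) ^ 2 * (τ - t) ^ 2 := by
        field_simp

variable {H : Type*} [NormedAddCommGroup H] [InnerProductSpace ℂ H] [CompleteSpace H]

lemma denseRange_of_isSelfAdjoint_of_injective {R : H →L[ℂ] H} (hR : IsSelfAdjoint R)
    (hinj : Function.Injective R) : DenseRange R := by
  have h := R.orthogonal_range
  rw [hR.adjoint_eq, LinearMap.ker_eq_bot.2 hinj, ← Submodule.topologicalClosure_eq_top_iff] at h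
  have h2 := (Submodule.dense_iff_topologicalClosure_eq_top (s := R.range)).2 h
  rwa [LinearMap.coe_range] at h2

/-- The operator `R e^{it(R⁻¹ - 1)}`. -/
noncomputable def smoothedFlow (R : H →L[ℂ] H) (t : ℝ) : H →L[ℂ] H := cfc (phase t) R

variable {R : H →L[ℂ] H}

lemma smoothedFlow_zero (hR : IsSelfAdjoint R) : smoothedFlow R 0 = R := by
  have hn := hR.isStarNormal
  conv_rhs => rw [← cfc_id' ℂ R]
  refine cfc_congr fun z hz => ?_
  rw [hR.mem_spectrum_eq_re hz]
  simp [phase]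

/-- On the real spectrum the phase factor has modulus one, so only `x²` survives. -/
lemma adjoint_smoothedFlow_mul (hR : IsSelfAdjoint R) (t : ℝ) :
    star (smoothedFlow R t) * smoothedFlow R t = R * R := by
  have hn := hR.isStarNormal
  have hc := (continuous_phase t).continuousOn (s := spectrum ℂ R)
  have h1 : R * R = cfc (fun z : ℂ => z * z) R := by
    rw [cfc_mul (fun z : ℂ => z) (fun z => z) R, cfc_id' ℂ R]
  rw [h1, smoothedFlow, ← cfc_star, ← cfc_mul _ _ R hc.star hc]
  refine cfc_congr fun z hz => ?_
  have h2 : star (phase t z) * phase t z = ((‖phase t z‖ ^ 2 : ℝ) : ℂ) := by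
    rw [Complex.ofReal_pow]
    exact Complex.conj_mul' _
  simp only [h2, norm_phase, sq_abs]
  conv_rhs => rw [hR.mem_spectrum_eq_re hz]
  push_cast
  ring

lemma norm_smoothedFlow_apply (hR : IsSelfAdjoint R) (t : ℝ) (y : H) :
    ‖smoothedFlow R t y‖ = ‖R y‖ := by
  have h := congrArg (fun A : H →L[ℂ] H => ⟪A y, y⟫_ℂ) (adjoint_smoothedFlow_mul hR t)
  have h2 : ⟪R (R y), y⟫_ℂ = ⟪R y, R y⟫_ℂ := by
    rw [← ContinuousLinearMap.adjoint_inner_right, hR.adjoint_eq]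
  simp only [mul_apply_eq_comp,
    ContinuousLinearMap.star_eq_adjoint, ContinuousLinearMap.adjoint_inner_left, h2,
    inner_self_eq_norm_sq_to_K] at h
  have h3 : ‖smoothedFlow R t y‖ ^ 2 = ‖R y‖ ^ 2 := by exact_mod_cast h
  exact (pow_left_inj₀ (norm_nonneg _) (norm_nonneg _) two_ne_zero).1 h3

lemma exists_abs_one_sub_re_le (R : H →L[ℂ] H) :
    ∃ C : ℝ, 0 ≤ C ∧ ∀ z ∈ spectrum ℂ R, |1 - z.re| ≤ C := by
  refine ⟨1 + ‖R‖ * ‖(1 : H →L[ℂ] H)‖, by positivity, fun z hz => ?_⟩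
  calc |1 - z.re| ≤ |1| + |z.re| := abs_sub _ _
    _ ≤ 1 + ‖z‖ := by rw [abs_one]; gcongr; exact Complex.abs_re_le_norm z
    _ ≤ _ := by gcongr; exact spectrum.norm_le_norm_mul_of_mem hz

lemma continuous_smoothedFlow (hR : IsSelfAdjoint R) : Continuous (smoothedFlow R) := by
  have hn := hR.isStarNormal
  obtain ⟨C, hC0, hC⟩ := exists_abs_one_sub_re_le R
  refine (LipschitzWith.of_dist_le_mul (K := ⟨C, hC0⟩) fun τ t => ?_).continuous
  rw [dist_eq_norm, smoothedFlow, smoothedFlow, ← cfc_sub _ _ R (continuous_phase τ).continuousOn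
    (continuous_phase t).continuousOn]
  refine norm_cfc_le (by positivity) fun z hz => (norm_phase_sub_le t τ z).trans ?_
  rw [mul_comm]
  exact mul_le_mul_of_nonneg_right (hC z hz) (abs_nonneg _)

lemma hasDerivAt_mul_smoothedFlow (hR : IsSelfAdjoint R) (t : ℝ) :
    HasDerivAt (fun τ => R * smoothedFlow R τ)
      (Complex.I • ((1 - R) * smoothedFlow R t)) t := by
  have hn := hR.isStarNormal
  obtain ⟨C, hC0, hC⟩ := exists_abs_one_sub_re_le R
  have hc := fun t => (continuous_phase t).continuousOn (s := spectrum ℂ R)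
  have hid : cfc (fun z : ℂ => (z.re : ℂ)) R = R := by
    conv_rhs => rw [← cfc_id' ℂ R]
    exact cfc_congr fun z hz => (hR.mem_spectrum_eq_re hz).symm
  have hre : ContinuousOn (fun z : ℂ => (z.re : ℂ)) (spectrum ℂ R) := by fun_prop
  have h1 : ∀ τ, R * smoothedFlow R τ = cfc (fun z : ℂ => (z.re : ℂ) * phase τ z) R := fun τ => by
    rw [cfc_mul _ _ R hre (hc τ), hid, smoothedFlow]
  have h2 : (1 - R) * smoothedFlow R t = cfc (fun z : ℂ => (1 - (z.re : ℂ)) * phase t z) R := by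
    rw [cfc_mul _ _ R (by fun_prop) (hc t), cfc_sub _ _ R (by fun_prop) hre, hid, cfc_const_one ℂ R,
      smoothedFlow]
  have hc' := hc t
  have hbound : ∀ τ, ‖R * smoothedFlow R τ - R * smoothedFlow R t
      - (τ - t) • (Complex.I • ((1 - R) * smoothedFlow R t))‖ ≤ 2 * C ^ 2 * (τ - t) ^ 2 := by
    intro τ
    have hcτ := hc τ
    have h3 : (τ - t) • (Complex.I • ((1 - R) * smoothedFlow R t))
        = cfc (fun z : ℂ => ((τ - t : ℝ) : ℂ) * (Complex.I * ((1 - (z.re : ℂ)) * phase t z))) R := by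
      rw [cfc_const_mul _ _ R (by fun_prop), cfc_const_mul _ _ R (by fun_prop), ← h2]
      rfl
    rw [h1, h1, h3, ← cfc_sub _ _ R (by fun_prop) (by fun_prop),
      ← cfc_sub _ _ R (by fun_prop) (by fun_prop)]
    refine norm_cfc_le (by positivity) fun z hz => (norm_phase_taylor_le t τ z).trans ?_
    gcongr 2 * ?_ * _
    rw [← sq_abs]
    gcongr
    exact hC z hz
  rw [hasDerivAt_iff_isLittleO]
  refine Asymptotics.IsBigO.trans_isLittleO (g := fun τ => (τ - t) ^ 2) ?_ ?_
  · refine Asymptotics.IsBigO.of_bound (2 * C ^ 2) (Eventually.of_forall fun τ => ?_)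
    simpa using hbound τ
  · have h4 : (fun x : ℝ => x ^ 2) =o[𝓝 0] fun x => x := by
      simpa using Asymptotics.isLittleO_pow_pow (𝕜 := ℝ) (m := 1) (n := 2) (by norm_num)
    refine h4.comp_tendsto (k := fun τ => τ - t) ?_
    have : ContinuousAt (fun τ : ℝ => τ - t) t := by fun_prop
    simpa [ContinuousAt] using this

/-- For an injective self-adjoint `R` the equation `d/dt (R h) = i (1 - R) h` has a solution for all
initial data, and its norm is bounded by that of the data. -/
theorem exists_flow (hR : IsSelfAdjoint R) (hinj : Function.Injective R) (x : H) :
    ∃ h : ℝ → H, Continuous h ∧ h 0 = x ∧ (∀ t, ‖h t‖ ≤ ‖x‖) ∧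
      ∀ t, HasDerivAt (fun τ => R (h τ)) (Complex.I • (h t - R (h t))) t := by
  have hd : DenseRange R := denseRange_of_isSelfAdjoint_of_injective hR hinj
  have hW : ∀ t y, ‖smoothedFlow R t y‖ ≤ 1 * ‖R y‖ := fun t y => by
    rw [norm_smoothedFlow_apply hR, one_mul]
  -- `R y ↦ smoothedFlow R t y` is isometric on the dense range of `R`; its extension plays the role
  -- of `e^{it(R⁻¹ - 1)}`.
  let U : ℝ → H →L[ℂ] H := fun t =>
    (smoothedFlow R t : H →ₗ[ℂ] H).extendOfNorm (R : H →ₗ[ℂ] H)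
  have hU : ∀ t y, U t (R y) = smoothedFlow R t y := fun t y =>
    LinearMap.extendOfNorm_eq (f := (smoothedFlow R t : H →ₗ[ℂ] H)) (e := (R : H →ₗ[ℂ] H))
      hd ⟨1, hW t⟩ y
  have hUn : ∀ t x, ‖U t x‖ ≤ ‖x‖ := fun t x => by
    simpa using LinearMap.norm_extendOfNorm_apply_le (f := (smoothedFlow R t : H →ₗ[ℂ] H))
      (e := (R : H →ₗ[ℂ] H)) hd 1 (hW t) x
  obtain ⟨y, hy⟩ : ∃ y : ℕ → H, Tendsto (fun n => R (y n)) atTop (𝓝 x) := by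
    obtain ⟨w, hw, hwx⟩ := mem_closure_iff_seq_limit.1 (hd x)
    choose y hy using hw
    exact ⟨y, by simpa only [hy] using hwx⟩
  -- Each `U t` is a contraction, so the approximation is uniform in `t`; continuity and the
  -- differential equation pass to the limit.
  have hunif : TendstoUniformly (fun n t => U t (R (y n))) (fun t => U t x) atTop := by
    rw [Metric.tendstoUniformly_iff]
    intro ε hε
    filter_upwards [Metric.tendsto_nhds.1 hy ε hε] with n hn t
    rw [dist_eq_norm, ← map_sub]
    refine (hUn t _).trans_lt ?_
    rwa [← dist_eq_norm, dist_comm]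
  refine ⟨fun t => U t x, ?_, ?_, fun t => hUn t x, ?_⟩
  · refine hunif.continuous (Frequently.of_forall fun n => ?_)
    simp only [hU]
    exact (continuous_smoothedFlow hR).clm_apply continuous_const
  · refine tendsto_nhds_unique ((hunif.tendsto_at 0)) ?_
    simpa only [hU, smoothedFlow_zero hR] using hy
  · have h1 : TendstoUniformly (fun n t => Complex.I • (U t (R (y n)) - R (U t (R (y n)))))
        (fun t => Complex.I • (U t x - R (U t x))) atTop :=
      (Complex.I • (ContinuousLinearMap.id ℂ H - R)).uniformContinuous.comp_tendstoUniformly hunif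
    refine hasDerivAt_of_tendstoUniformly (f := fun n t => R (U t (R (y n)))) h1
      (Eventually.of_forall fun n t => ?_) fun t =>
        (R.continuous.tendsto _).comp (hunif.tendsto_at t)
    simp only [hU]
    exact ((ContinuousLinearMap.apply ℂ H (y n)).restrictScalars ℝ).hasFDerivAt.comp_hasDerivAt t
      (hasDerivAt_mul_smoothedFlow hR t)

end AbstractFlow

/-! ### The abstract Cauchy problem with a bounded positive perturbation -/

section AbstractCauchyProblem

variable {H : Type*} [NormedAddCommGroup H] [InnerProductSpace ℂ H] [CompleteSpace H]

/-- The square root of the coercive operator `1 + J Q J`, together with its inverse. -/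
lemma exists_sqrt_one_add_conj {J Q : H →L[ℂ] H} (hJ : IsSelfAdjoint J) (hQ : Q.IsPositive)
    (hJn : ∀ x, ‖J x‖ ≤ ‖x‖) :
    ∃ D B : H →L[ℂ] H, IsSelfAdjoint D ∧ IsSelfAdjoint B ∧
      (∀ x, D (D x) = x + J (Q (J x))) ∧ (∀ x, D (B x) = x) ∧ (∀ x, B (D x) = x) ∧
      (∀ x, ‖B x‖ ≤ ‖x‖) ∧ ∀ x, ‖D x‖ ≤ (1 + ‖Q‖) * ‖x‖ := by
  set C : H →L[ℂ] H := 1 + J * Q * J with hCdef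
  have hCx : ∀ x, C x = x + J (Q (J x)) := fun x => rfl
  have hinner : ∀ x, ⟪x, C x⟫_ℂ = ⟪x, x⟫_ℂ + ⟪J x, Q (J x)⟫_ℂ := fun x => by
    rw [hCx, inner_add_right, ← ContinuousLinearMap.adjoint_inner_left, hJ.adjoint_eq]
  have hre : ∀ x, RCLike.re ⟪x, C x⟫_ℂ = ‖x‖ ^ 2 + RCLike.re ⟪J x, Q (J x)⟫_ℂ := fun x => by
    rw [hinner, map_add, inner_self_eq_norm_sq]
  have hpos : ∀ x, ‖x‖ ^ 2 ≤ RCLike.re ⟪x, C x⟫_ℂ := fun x => by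
    rw [hre]
    exact le_add_of_nonneg_right (hQ.re_inner_nonneg_right _)
  have hC0 : 0 ≤ C := by
    rw [ContinuousLinearMap.nonneg_iff_isPositive]
    refine ContinuousLinearMap.isPositive_one.add ?_
    have := hQ.adjoint_conj J
    rwa [hJ.adjoint_eq] at this
  -- Coercivity `‖x‖² ≤ re ⟪x, C x⟫` makes `C` invertible, and then its square root too.
  have hCu : IsUnit C := by
    refine ContinuousLinearMap.isUnit_of_forall_le_norm_inner_map C (c := 1) one_pos fun x => ?_
    rw [← inner_conj_symm, RCLike.norm_conj]
    simpa using (hpos x).trans (RCLike.re_le_norm _)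
  set D := CFC.sqrt C
  have hD : IsSelfAdjoint D := (CFC.sqrt_nonneg C).isSelfAdjoint
  have hDD : D * D = C := CFC.sqrt_mul_sqrt_self C hC0
  obtain ⟨u, hu⟩ := (CFC.isUnit_sqrt_iff C hC0).2 hCu
  change (u : H →L[ℂ] H) = D at hu
  have hDn : ∀ x, ‖D x‖ ^ 2 = ‖x‖ ^ 2 + RCLike.re ⟪J x, Q (J x)⟫_ℂ := fun x => by
    rw [← hre, ← hDD, mul_apply_eq_comp, ← ContinuousLinearMap.adjoint_inner_left, hD.adjoint_eq,
      inner_self_eq_norm_sq]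
  have hDlow : ∀ x, ‖x‖ ≤ ‖D x‖ := fun x => by
    refine (pow_le_pow_iff_left₀ (norm_nonneg _) (norm_nonneg _) two_ne_zero).1 ?_
    rw [hDn]
    exact le_add_of_nonneg_right (hQ.re_inner_nonneg_right _)
  have hDB : ∀ x, D ((↑u⁻¹ : H →L[ℂ] H) x) = x := fun x => by
    rw [← hu, ← mul_apply_eq_comp, u.mul_inv]
    rfl
  have hBD : ∀ x, (↑u⁻¹ : H →L[ℂ] H) (D x) = x := fun x => by
    rw [← hu, ← mul_apply_eq_comp, u.inv_mul]
    rfl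
  refine ⟨D, ↑u⁻¹, hD, ?_, fun x => ?_, hDB, hBD, fun x => ?_, fun x => ?_⟩
  · have : IsSelfAdjoint u := Units.ext (by rw [Units.coe_star, hu]; exact hD)
    rw [IsSelfAdjoint, ← Units.coe_star, star_inv, this.star_eq]
  · rw [← mul_apply_eq_comp, hDD, hCx]
  · simpa only [hDB] using hDlow ((↑u⁻¹ : H →L[ℂ] H) x)
  -- `‖D x‖² ≤ (1 + ‖Q‖) ‖x‖²`, and `1 + ‖Q‖ ≤ (1 + ‖Q‖)²`.
  · refine (pow_le_pow_iff_left₀ (norm_nonneg _) (by positivity) two_ne_zero).1 ?_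
    rw [hDn]
    have h1 : RCLike.re ⟪J x, Q (J x)⟫_ℂ ≤ ‖x‖ * (‖Q‖ * ‖x‖) :=
      (re_inner_le_norm _ _).trans (mul_le_mul (hJn x)
        ((Q.le_opNorm _).trans (by gcongr; exact hJn x)) (norm_nonneg _) (norm_nonneg _))
    nlinarith [norm_nonneg Q, norm_nonneg x, mul_nonneg (norm_nonneg Q) (sq_nonneg ‖x‖),
      sq_nonneg (‖Q‖ * ‖x‖)]

/-- A weak solution of `d/dt (R h) = i (1 - R) h` with zero initial data vanishes. -/
theorem flow_unique {R : H →L[ℂ] H} (hR : IsSelfAdjoint R) (hinj : Function.Injective R)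
    {T : ℝ} (hT : 0 ≤ T) {h : ℝ → H} (hc : ContinuousOn h (Icc 0 T)) (h0 : h 0 = 0)
    (heq : ∀ t ∈ Icc 0 T, ∀ g : H, HasDerivWithinAt (fun τ => ⟪g, R (h τ)⟫_ℂ)
      ⟪g, Complex.I • (h t - R (h t))⟫_ℂ (Icc 0 T) t) :
    ∀ t ∈ Icc 0 T, h t = 0 := by
  set k : ℝ → H := fun t => Complex.I • (h t - R (h t)) with hk
  have hkc : ContinuousOn k (Icc 0 T) :=
    (hc.sub (R.continuous.comp_continuousOn hc)).const_smul _
  -- A continuous extension to `ℝ` allows the fundamental theorem of calculus at the end points as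
  -- well.
  set k' : ℝ → H := IccExtend hT ((Icc 0 T).domRestrict k)
  have hk'c : Continuous k' := (continuousOn_iff_continuous_domRestrict.1 hkc).Icc_extend'
  have hk' : ∀ t ∈ Icc 0 T, k' t = k t := fun t ht => IccExtend_of_mem hT _ ht
  have hF : ∀ t, HasDerivAt (fun τ => ∫ x in (0 : ℝ)..τ, k' x) (k' t) t := fun t =>
    hk'c.integral_hasStrictDerivAt 0 t |>.hasDerivAt
  have hmem0 : (0 : ℝ) ∈ Icc 0 T := ⟨le_rfl, hT⟩
  -- The weak equation becomes a norm-differentiable one: tested with any `g`, both sides have the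
  -- same derivative and vanish at `0`.
  have hRh : ∀ t ∈ Icc 0 T, R (h t) = ∫ x in (0 : ℝ)..t, k' x := by
    intro t ht
    refine ext_inner_left ℂ fun g => ?_
    have hd : ∀ τ ∈ Icc 0 T, HasDerivWithinAt
        (fun τ => ⟪g, R (h τ)⟫_ℂ - ⟪g, ∫ x in (0 : ℝ)..τ, k' x⟫_ℂ) 0 (Icc 0 T) τ := by
      intro τ hτ
      have h1 : HasDerivWithinAt (fun τ => ⟪g, ∫ x in (0 : ℝ)..τ, k' x⟫_ℂ) ⟪g, k' τ⟫_ℂ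
          (Icc 0 T) τ := by
        simpa using (hasDerivWithinAt_const τ (Icc 0 T) g).inner ℂ (hF τ).hasDerivWithinAt
      exact ((heq τ hτ g).sub h1).congr_deriv (by rw [hk' τ hτ, sub_self])
    have h2 := (convex_Icc 0 T).norm_image_sub_le_of_norm_hasDerivWithin_le (C := 0) hd
      (fun _ _ => by simp) hmem0 ht
    rw [zero_mul, norm_le_zero_iff, sub_eq_zero] at h2
    simpa [h0, sub_eq_zero] using h2
  have hderiv : ∀ t ∈ Icc 0 T, HasDerivWithinAt (fun τ => R (h τ)) (k t) (Icc 0 T) t := by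
    intro t ht
    rw [← hk' t ht]
    exact (hF t).hasDerivWithinAt.congr hRh (hRh t ht)
  -- Conservation of `‖R h‖²`: the cross terms cancel because `⟪R h, h⟫` is real.
  have hzero : ∀ t ∈ Icc 0 T, HasDerivWithinAt (fun τ => ⟪R (h τ), R (h τ)⟫_ℂ) 0 (Icc 0 T) t := by
    intro t ht
    have h1 := (hderiv t ht).inner ℂ (hderiv t ht)
    have h2 : ⟪R (h t), h t⟫_ℂ = ⟪h t, R (h t)⟫_ℂ := by
      rw [← ContinuousLinearMap.adjoint_inner_right, hR.adjoint_eq]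
    have h3 : ⟪R (h t), k t⟫_ℂ + ⟪k t, R (h t)⟫_ℂ = 0 := by
      simp only [hk, inner_smul_left, inner_smul_right, inner_sub_left, inner_sub_right, h2,
        Complex.conj_I]
      ring
    rwa [h3] at h1
  intro t ht
  have h2 := (convex_Icc 0 T).norm_image_sub_le_of_norm_hasDerivWithin_le (C := 0) hzero
    (fun _ _ => by simp) hmem0 ht
  rw [zero_mul, norm_le_zero_iff, sub_eq_zero, h0, map_zero, inner_zero_left,
    inner_self_eq_zero] at h2
  exact hinj (by rw [h2, map_zero])

/-- Existence for the equation `d/dt J² f = i (f - J² f + J Q J f)` in weak form. -/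
theorem exists_weak_solution {J Q : H →L[ℂ] H} (hJ : IsSelfAdjoint J)
    (hJinj : Function.Injective J) (hQ : Q.IsPositive) (hJn : ∀ x, ‖J x‖ ≤ ‖x‖) (f₀ : H) :
    ∃ f : ℝ → H, Continuous f ∧ f 0 = f₀ ∧ (∀ t, ‖f t‖ ≤ (1 + ‖Q‖) * ‖f₀‖) ∧
      ∀ t g, HasDerivAt (fun τ => ⟪J g, J (f τ)⟫_ℂ)
        (Complex.I * (⟪g, f t⟫_ℂ - ⟪J g, J (f t)⟫_ℂ + ⟪J g, Q (J (f t))⟫_ℂ)) t := by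
  obtain ⟨D, B, hD, hB, hDD, hDB, hBD, hBn, hDn⟩ := exists_sqrt_one_add_conj hJ hQ hJn
  have hJi : ∀ x y, ⟪J x, y⟫_ℂ = ⟪x, J y⟫_ℂ := fun x y => by
    rw [← ContinuousLinearMap.adjoint_inner_right, hJ.adjoint_eq]
  have hDi : ∀ x y, ⟪D x, y⟫_ℂ = ⟪x, D y⟫_ℂ := fun x y => by
    rw [← ContinuousLinearMap.adjoint_inner_right, hD.adjoint_eq]
  have hR : IsSelfAdjoint (B * (J * J) * B) := by
    rw [IsSelfAdjoint]
    simp only [star_mul, hB.star_eq, hJ.star_eq, mul_assoc]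
  have hBinj : Function.Injective B := Function.LeftInverse.injective hDB
  have hRinj : Function.Injective (B * (J * J) * B) :=
    hBinj.comp (hJinj.comp (hJinj.comp hBinj))
  obtain ⟨h, hc, h0, hn, hd⟩ := exists_flow hR hRinj (D f₀)
  refine ⟨fun t => B (h t), B.continuous.comp hc, by simp only [h0, hBD], fun t =>
    (hBn _).trans ((hn t).trans (hDn f₀)), fun t g => ?_⟩
  -- Testing with `D g` removes the outer `B` from `R`, as `D B = 1`.
  have h1 := (hasDerivAt_const t (D g)).inner ℂ (hd t)
  have h2 : ∀ y, ⟪D g, (B * (J * J) * B) y⟫_ℂ = ⟪J g, J (B y)⟫_ℂ := fun y => by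
    simp only [mul_apply_eq_comp, hDi, hDB, hJi]
  simp only [h2, inner_zero_left, add_zero] at h1
  have h3 : ⟪D g, h t⟫_ℂ = ⟪g, B (h t)⟫_ℂ + ⟪J g, Q (J (B (h t)))⟫_ℂ := by
    rw [hJi, ← inner_add_right, ← hDD, hDB, hDi]
  refine h1.congr_deriv ?_
  rw [inner_smul_right, inner_sub_right, h2, h3]
  ring

/-- Uniqueness for the equation `d/dt J² f = i (f - J² f + J Q J f)` in weak form. -/
theorem weak_solution_unique {J Q : H →L[ℂ] H} (hJ : IsSelfAdjoint J)
    (hJinj : Function.Injective J) (hQ : Q.IsPositive) (hJn : ∀ x, ‖J x‖ ≤ ‖x‖)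
    {T : ℝ} (hT : 0 ≤ T) {f : ℝ → H} (hc : ContinuousOn f (Icc 0 T)) (h0 : f 0 = 0)
    (heq : ∀ t ∈ Icc 0 T, ∀ g : H, HasDerivWithinAt (fun τ => ⟪J g, J (f τ)⟫_ℂ)
      (Complex.I * (⟪g, f t⟫_ℂ - ⟪J g, J (f t)⟫_ℂ + ⟪J g, Q (J (f t))⟫_ℂ)) (Icc 0 T) t) :
    ∀ t ∈ Icc 0 T, f t = 0 := by
  obtain ⟨D, B, hD, hB, hDD, hDB, hBD, hBn, hDn⟩ := exists_sqrt_one_add_conj hJ hQ hJn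
  have hJi : ∀ x y, ⟪J x, y⟫_ℂ = ⟪x, J y⟫_ℂ := fun x y => by
    rw [← ContinuousLinearMap.adjoint_inner_right, hJ.adjoint_eq]
  have hBi : ∀ x y, ⟪B x, y⟫_ℂ = ⟪x, B y⟫_ℂ := fun x y => by
    rw [← ContinuousLinearMap.adjoint_inner_right, hB.adjoint_eq]
  have hR : IsSelfAdjoint (B * (J * J) * B) := by
    rw [IsSelfAdjoint]
    simp only [star_mul, hB.star_eq, hJ.star_eq, mul_assoc]
  have hBinj : Function.Injective B := Function.LeftInverse.injective hDB
  have hRinj : Function.Injective (B * (J * J) * B) :=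
    hBinj.comp (hJinj.comp (hJinj.comp hBinj))
  have h2 : ∀ g y, ⟪g, (B * (J * J) * B) (D y)⟫_ℂ = ⟪J (B g), J y⟫_ℂ := fun g y => by
    simp only [mul_apply_eq_comp, hBi, hBD, hJi]
  intro t ht
  have h1 := flow_unique hR hRinj hT (h := fun τ => D (f τ)) (D.continuous.comp_continuousOn hc)
    (by simp [h0]) (fun τ hτ g => ?_) t ht
  · rw [← hBD (f t), h1, map_zero]
  · simp only [h2]
    have h3 : ⟪g, D (f τ)⟫_ℂ = ⟪B g, f τ⟫_ℂ + ⟪J (B g), Q (J (f τ))⟫_ℂ := by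
      rw [hJi, ← inner_add_right, ← hDD, hBi, hBD]
    refine (heq τ hτ (B g)).congr_deriv ?_
    rw [inner_smul_right, inner_sub_right, h2, h3]
    ring

end AbstractCauchyProblem

variable {d : ℕ}

/-! ### Multiplication by bounded real functions -/

/-- Multiplication by a real function in `L^∞` as an operator on `L²`. -/
noncomputable def linftyMul (p : Linfty d) : L2 d →L[ℂ] L2 d :=
  LinearMap.mkContinuous
    { toFun := fun u => (p • u : L2 d)
      map_add' := fun u v => Lp.add_smul p u v
      map_smul' := fun c u => by
        refine Lp.ext ?_
        filter_upwards [Lp.coeFn_lpSMul (r := 2) p (c • u), Lp.coeFn_smul c u,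
          Lp.coeFn_smul c (p • u : L2 d), Lp.coeFn_lpSMul (r := 2) p u] with x h1 h2 h3 h4
        simp only [RingHom.id_apply, h1, h3, Pi.smul_apply, Pi.smul_apply', h2, h4]
        exact smul_comm _ _ _ }
    ‖p‖ fun u => Lp.norm_smul_le p u

lemma linftyMul_apply (p : Linfty d) (u : L2 d) : linftyMul p u = (p • u : L2 d) := rfl

lemma norm_linftyMul_le (p : Linfty d) : ‖linftyMul p‖ ≤ ‖p‖ :=
  LinearMap.mkContinuous_norm_le _ (norm_nonneg _) _

lemma coeFn_linftyMul (p : Linfty d) (u : L2 d) :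
    linftyMul p u =ᵐ[volume] fun x => ((p x : ℝ) : ℂ) * u x := by
  filter_upwards [Lp.coeFn_lpSMul (r := 2) p u] with x hx
  rw [linftyMul_apply, hx]
  simp

lemma isSelfAdjoint_linftyMul (p : Linfty d) : IsSelfAdjoint (linftyMul p) := by
  rw [ContinuousLinearMap.isSelfAdjoint_iff_isSymmetric]
  intro u v
  simp only [ContinuousLinearMap.coe_coe, L2.inner_def]
  refine integral_congr_ae ?_
  filter_upwards [coeFn_linftyMul p u, coeFn_linftyMul p v] with x hu hv
  rw [hu, hv]
  simp
  ring

lemma isPositive_linftyMul {p : Linfty d} (hp : 0 ≤ p) : (linftyMul p).IsPositive := by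
  rw [ContinuousLinearMap.isPositive_def']
  refine ⟨isSelfAdjoint_linftyMul p, fun u => ?_⟩
  rw [ContinuousLinearMap.reApplyInnerSelf_apply, L2.inner_def, ← integral_re
    (L2.integrable_inner _ _)]
  refine integral_nonneg_of_ae ?_
  filter_upwards [coeFn_linftyMul p u, (Lp.coeFn_nonneg p).2 hp] with x hu hx
  rw [hu]
  have h : ⟪((p x : ℝ) : ℂ) * u x, u x⟫_ℂ = ((p x * ‖u x‖ ^ 2 : ℝ) : ℂ) := by
    rw [← smul_eq_mul, inner_smul_left, inner_self_eq_norm_sq_to_K]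
    simp
  rw [h]
  exact mul_nonneg hx (sq_nonneg _)

/-! ### The Bessel potential -/

/-- The symbol `(2π|ξ|)^s` of `(-Δ)^{s/2}`. -/
noncomputable def fracSymbol (s : ℝ) (ξ : Space d) : ℝ := (2 * Real.pi * ‖ξ‖) ^ (2 * (s / 2))

/-- The symbol `(1 + (2π|ξ|)^{2s})^{-1/2}`. -/
noncomputable def besselSymbol (s : ℝ) (ξ : Space d) : ℝ := (√(1 + fracSymbol s ξ ^ 2))⁻¹

lemma measurable_fracSymbol (s : ℝ) : Measurable (fracSymbol (d := d) s) := by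
  unfold fracSymbol
  fun_prop

lemma measurable_besselSymbol (s : ℝ) : Measurable (besselSymbol (d := d) s) := by
  have := measurable_fracSymbol (d := d) s
  unfold besselSymbol
  fun_prop

lemma besselSymbol_pos (s : ℝ) (ξ : Space d) : 0 < besselSymbol s ξ := by
  unfold besselSymbol
  positivity

lemma besselSymbol_sq_add (s : ℝ) (ξ : Space d) :
    (fracSymbol s ξ * besselSymbol s ξ) ^ 2 + besselSymbol s ξ ^ 2 = 1 := by
  have h : (0 : ℝ) < 1 + fracSymbol s ξ ^ 2 := by positivity
  rw [mul_pow, besselSymbol, inv_pow, Real.sq_sqrt h.le]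
  field_simp
  ring

lemma abs_besselSymbol_le (s : ℝ) (ξ : Space d) : |besselSymbol s ξ| ≤ 1 := by
  rw [← sq_le_one_iff_abs_le_one]
  nlinarith [besselSymbol_sq_add s ξ, sq_nonneg (fracSymbol s ξ * besselSymbol s ξ)]

lemma abs_fracSymbol_mul_besselSymbol_le (s : ℝ) (ξ : Space d) :
    |fracSymbol s ξ * besselSymbol s ξ| ≤ 1 := by
  rw [← sq_le_one_iff_abs_le_one]
  nlinarith [besselSymbol_sq_add s ξ, sq_nonneg (besselSymbol s ξ)]

lemma memLp_besselSymbol (s : ℝ) :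
    MemLp (besselSymbol (d := d) s) ∞ (volume : Measure (Space d)) :=
  memLp_top_of_bound (measurable_besselSymbol s).aestronglyMeasurable 1
    (Eventually.of_forall (abs_besselSymbol_le s))

/-- The operator `(1 + (-Δ)^s)^{-1/2}` on `L²`, whose range is `H^s`. -/
noncomputable def besselPotential (s : ℝ) : L2 d →L[ℂ] L2 d :=
  ((Lp.fourierTransformₗᵢ (Space d) ℂ).symm.toContinuousLinearEquiv : L2 d →L[ℂ] L2 d) ∘L
    linftyMul ((memLp_besselSymbol s).toLp (besselSymbol s)) ∘L
    ((Lp.fourierTransformₗᵢ (Space d) ℂ).toContinuousLinearEquiv : L2 d →L[ℂ] L2 d)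

lemma besselPotential_apply (s : ℝ) (f : L2 d) : besselPotential s f =
    (𝓕⁻ (linftyMul ((memLp_besselSymbol s).toLp (besselSymbol s)) (𝓕 f : L2 d)) : L2 d) := rfl

lemma fourier_besselPotential (s : ℝ) (f : L2 d) :
    (𝓕 (besselPotential s f) : L2 d) =ᵐ[volume]
      fun ξ => ((besselSymbol s ξ : ℝ) : ℂ) * (𝓕 f : L2 d) ξ := by
  rw [besselPotential_apply, FourierTransform.fourier_fourierInv_eq]
  filter_upwards [coeFn_linftyMul ((memLp_besselSymbol s).toLp (besselSymbol s)) (𝓕 f : L2 d),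
    (memLp_besselSymbol (d := d) s).coeFn_toLp] with ξ h1 h2
  rw [h1, h2]

lemma isSelfAdjoint_besselPotential (s : ℝ) : IsSelfAdjoint (besselPotential (d := d) s) := by
  rw [ContinuousLinearMap.isSelfAdjoint_iff_isSymmetric]
  intro u v
  simp only [ContinuousLinearMap.coe_coe]
  rw [← Lp.inner_fourier_eq, ← Lp.inner_fourier_eq u, besselPotential_apply, besselPotential_apply,
    FourierTransform.fourier_fourierInv_eq, FourierTransform.fourier_fourierInv_eq]
  exact (isSelfAdjoint_linftyMul _).isSymmetric _ _

lemma fracSymbolMul_besselPotential (s : ℝ) (f : L2 d) :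
    fracSymbolMul (s / 2) (besselPotential s f) =ᵐ[volume]
      fun ξ => ((fracSymbol s ξ * besselSymbol s ξ : ℝ) : ℂ) * (𝓕 f : L2 d) ξ := by
  filter_upwards [fourier_besselPotential s f] with ξ h
  rw [fracSymbolMul, h, ← mul_assoc, ← Complex.ofReal_mul]
  rfl

lemma memHs_besselPotential (s : ℝ) (f : L2 d) : MemHs s (besselPotential s f) := by
  rw [MemHs, MemFracDomain, memLp_congr_ae (fracSymbolMul_besselPotential s f)]
  have hm := (measurable_fracSymbol (d := d) s).mul (measurable_besselSymbol s)
  refine (Lp.memLp (𝓕 f : L2 d)).of_le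
    ((Complex.measurable_ofReal.comp hm).aestronglyMeasurable.mul (Lp.aestronglyMeasurable _))
    (Eventually.of_forall fun ξ => ?_)
  rw [norm_mul, Complex.norm_real]
  exact mul_le_of_le_one_left (norm_nonneg _) (abs_fracSymbol_mul_besselSymbol_le s ξ)

lemma fourier_fracLaplacian_besselPotential (s : ℝ) (f : L2 d) :
    (𝓕 (fracLaplacian (s / 2) (besselPotential s f)) : L2 d) =ᵐ[volume]
      fun ξ => ((fracSymbol s ξ * besselSymbol s ξ : ℝ) : ℂ) * (𝓕 f : L2 d) ξ := by
  have h : MemFracDomain (s / 2) (besselPotential s f) := memHs_besselPotential s f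
  rw [fracLaplacian, dif_pos h, FourierTransform.fourier_fourierInv_eq]
  exact h.coeFn_toLp.trans (fracSymbolMul_besselPotential s f)

/-- Plancherel and `besselSymbol_sq_add`, i.e. `J A J = 1 - J²`; this carries the form of `(-Δ)^s`
over to bounded operators. -/
lemma inner_fracLaplacian_besselPotential (s : ℝ) (g f : L2 d) :
    ⟪fracLaplacian (s / 2) (besselPotential s g), fracLaplacian (s / 2) (besselPotential s f)⟫_ℂ
      = ⟪g, f⟫_ℂ - ⟪besselPotential s g, besselPotential s f⟫_ℂ := by
  rw [eq_sub_iff_add_eq, ← Lp.inner_fourier_eq, ← Lp.inner_fourier_eq (besselPotential s g),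
    ← Lp.inner_fourier_eq g, L2.inner_def, L2.inner_def, L2.inner_def,
    ← integral_add (L2.integrable_inner _ _) (L2.integrable_inner _ _)]
  refine integral_congr_ae ?_
  filter_upwards [fourier_besselPotential s f, fourier_besselPotential s g,
    fourier_fracLaplacian_besselPotential s f, fourier_fracLaplacian_besselPotential s g]
    with ξ h1 h2 h3 h4
  have h5 : ((fracSymbol s ξ * besselSymbol s ξ : ℝ) : ℂ) ^ 2 + (besselSymbol s ξ : ℂ) ^ 2 = 1 := by
    exact_mod_cast besselSymbol_sq_add s ξ
  simp only [h1, h2, h3, h4, RCLike.inner_apply, map_mul, Complex.conj_ofReal]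
  linear_combination ((𝓕 f : L2 d) ξ * (starRingEnd ℂ) ((𝓕 g : L2 d) ξ)) * h5

lemma norm_sq_eq_besselPotential (s : ℝ) (f : L2 d) :
    ‖f‖ ^ 2 = ‖besselPotential s f‖ ^ 2 + ‖fracLaplacian (s / 2) (besselPotential s f)‖ ^ 2 := by
  have h := inner_fracLaplacian_besselPotential s f f
  simp only [inner_self_eq_norm_sq_to_K] at h
  have h' : ‖fracLaplacian (s / 2) (besselPotential s f)‖ ^ 2
      = ‖f‖ ^ 2 - ‖besselPotential s f‖ ^ 2 := by exact_mod_cast h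
  linarith

lemma norm_besselPotential_le (s : ℝ) (f : L2 d) : ‖besselPotential s f‖ ≤ ‖f‖ :=
  (pow_le_pow_iff_left₀ (norm_nonneg _) (norm_nonneg _) two_ne_zero).1
    (norm_sq_eq_besselPotential s f ▸ le_add_of_nonneg_right (sq_nonneg _))

lemma hsNorm_besselPotential_le (s : ℝ) (f : L2 d) :
    hsNorm s (besselPotential s f) ≤ 2 * ‖f‖ := by
  have h : ‖fracLaplacian (s / 2) (besselPotential s f)‖ ≤ ‖f‖ :=
    (pow_le_pow_iff_left₀ (norm_nonneg _) (norm_nonneg _) two_ne_zero).1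
      (norm_sq_eq_besselPotential s f ▸ le_add_of_nonneg_left (sq_nonneg _))
  rw [hsNorm, two_mul]
  exact add_le_add (norm_besselPotential_le s f) h

lemma norm_le_hsNorm_besselPotential (s : ℝ) (f : L2 d) :
    ‖f‖ ≤ hsNorm s (besselPotential s f) := by
  unfold hsNorm
  refine (pow_le_pow_iff_left₀ (norm_nonneg _) (by positivity) two_ne_zero).1 ?_
  rw [norm_sq_eq_besselPotential s f]
  nlinarith [mul_nonneg (norm_nonneg (besselPotential s f))
    (norm_nonneg (fracLaplacian (s / 2) (besselPotential s f)))]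

lemma hsNorm_nonneg (s : ℝ) (u : L2 d) : 0 ≤ hsNorm s u := by
  unfold hsNorm
  positivity

lemma injective_besselPotential (s : ℝ) : Function.Injective (besselPotential (d := d) s) := by
  refine (injective_iff_map_eq_zero _).2 fun f hf => ?_
  have h1 := fourier_besselPotential s f
  rw [hf] at h1
  have h0 : (𝓕 (0 : L2 d) : L2 d) = 0 := map_zero (Lp.fourierTransformₗᵢ (Space d) ℂ)
  have h2 : (𝓕 f : L2 d) = 0 := by
    refine Lp.ext ?_
    rw [h0] at h1
    filter_upwards [h1, Lp.coeFn_zero ℂ 2 (volume : Measure (Space d))] with ξ h3 h4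
    rw [h4, Pi.zero_apply] at h3 ⊢
    exact (mul_eq_zero.1 h3.symm).resolve_left
      (Complex.ofReal_ne_zero.2 (besselSymbol_pos s ξ).ne')
  exact (map_eq_zero_iff _ (Lp.fourierTransformₗᵢ (Space d) ℂ).injective).1 h2

/-- The inverse symbol `√(1 + m²)` is at most `1 + |m|`, with `m` the symbol of `(-Δ)^{s/2}`, so
dividing `û` by the Bessel symbol stays in `L²`. -/
lemma exists_besselPotential_eq {s : ℝ} {u : L2 d} (hu : MemHs s u) :
    ∃ f, besselPotential s f = u := by
  have hm : Measurable fun ξ : Space d => (((besselSymbol s ξ)⁻¹ : ℝ) : ℂ) :=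
    Complex.measurable_ofReal.comp (measurable_besselSymbol s).inv
  have hL : MemLp (fun ξ => (((besselSymbol s ξ)⁻¹ : ℝ) : ℂ) * (𝓕 u : L2 d) ξ) 2
      (volume : Measure (Space d)) := by
    refine ((Lp.memLp (𝓕 u : L2 d)).norm.add hu.norm).of_le
      (hm.aestronglyMeasurable.mul (Lp.aestronglyMeasurable _)) (Eventually.of_forall fun ξ => ?_)
    have h1 : (besselSymbol s ξ)⁻¹ ≤ 1 + |fracSymbol s ξ| := by
      rw [besselSymbol, inv_inv]
      refine Real.sqrt_le_iff.2 ⟨by positivity, ?_⟩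
      nlinarith [sq_abs (fracSymbol s ξ), abs_nonneg (fracSymbol s ξ)]
    have h2 : ‖fracSymbolMul (s / 2) u ξ‖ = |fracSymbol s ξ| * ‖(𝓕 u : L2 d) ξ‖ := by
      rw [fracSymbolMul, norm_mul, Complex.norm_real]
      rfl
    have h3 := (inv_pos.2 (besselSymbol_pos s ξ)).le
    simp only [Pi.add_apply]
    rw [norm_mul, Complex.norm_real, Real.norm_of_nonneg h3, h2, ← one_add_mul,
      Real.norm_of_nonneg (by positivity)]
    gcongr
  refine ⟨(𝓕⁻ (hL.toLp _) : L2 d), (Lp.fourierTransformₗᵢ (Space d) ℂ).injective (Lp.ext ?_)⟩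
  refine (fourier_besselPotential s _).trans ?_
  rw [FourierTransform.fourier_fourierInv_eq]
  filter_upwards [hL.coeFn_toLp] with ξ h
  rw [h, ← mul_assoc, ← Complex.ofReal_mul, mul_inv_cancel₀ (besselSymbol_pos s ξ).ne',
    Complex.ofReal_one, one_mul]
  rfl

variable {s T : ℝ}

/-! ### The Cauchy problem with a bounded non-negative potential -/

lemma tendsto_hsNorm_besselPotential_sub {f : ℝ → L2 d} (hf : Continuous f) (t : ℝ) (S : Set ℝ) :
    Tendsto (fun τ => hsNorm s (besselPotential s (f τ) - besselPotential s (f t))) (𝓝[S] t)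
      (𝓝 0) := by
  have h : Tendsto (fun τ => 2 * ‖f τ - f t‖) (𝓝[S] t) (𝓝 0) := by
    have h1 : ContinuousAt (fun τ => 2 * ‖f τ - f t‖) t := by fun_prop
    simpa using h1.tendsto.mono_left nhdsWithin_le_nhds
  refine squeeze_zero (fun τ => hsNorm_nonneg s _) (fun τ => ?_) h
  rw [← map_sub]
  exact hsNorm_besselPotential_le s _

/-- Global existence in `C([0,T]; H^s)`. -/
theorem exists_isSolution (s T : ℝ) {p : Linfty d} (hp : 0 ≤ p) {u₀ : L2 d} (hu₀ : MemHs s u₀) :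
    ∃ u, IsSolution s T p u₀ u := by
  obtain ⟨f₀, rfl⟩ := exists_besselPotential_eq hu₀
  obtain ⟨f, hf, hf0, -, hd⟩ := exists_weak_solution (isSelfAdjoint_besselPotential s)
    (injective_besselPotential s) (isPositive_linftyMul hp) (norm_besselPotential_le s) f₀
  refine ⟨fun t => besselPotential s (f t), ⟨fun t _ => memHs_besselPotential s _, fun t _ =>
    tendsto_hsNorm_besselPotential_sub hf t _⟩, by simp only [hf0], fun t _ v hv => ?_⟩
  obtain ⟨g, rfl⟩ := exists_besselPotential_eq hv
  refine ⟨_, (hd t g).hasDerivWithinAt, ?_⟩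
  rw [inner_fracLaplacian_besselPotential, linftyMul_apply, ← mul_assoc, Complex.I_mul_I]
  ring

/-- Every solution is bounded in `H^s`, uniformly in time. -/
theorem IsSolution.hsNorm_le {p : Linfty d} (hp : 0 ≤ p) {u₀ : L2 d} {u : ℝ → L2 d}
    (h : IsSolution s T p u₀ u) {t : ℝ} (ht : t ∈ Icc 0 T) :
    hsNorm s (u t) ≤ 2 * (1 + ‖p‖) * hsNorm s u₀ := by
  have hT : 0 ≤ T := ht.1.trans ht.2
  have hmem0 : (0 : ℝ) ∈ Icc 0 T := ⟨le_rfl, hT⟩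
  -- Outside `[0,T]` nothing is known about `u t`; the value `0` there only makes `f` total.
  have hJu : ∀ t, ∃ f, t ∈ Icc (0 : ℝ) T → besselPotential s f = u t := fun t => by
    by_cases ht : t ∈ Icc 0 T
    · obtain ⟨f, hf⟩ := exists_besselPotential_eq (h.continuousHs.1 t ht)
      exact ⟨f, fun _ => hf⟩
    · exact ⟨0, fun h => absurd h ht⟩
  choose f hf using hJu
  have hfc : ContinuousOn f (Icc 0 T) := fun t ht => by
    rw [ContinuousWithinAt, tendsto_iff_norm_sub_tendsto_zero]
    refine squeeze_zero' (Eventually.of_forall fun τ => norm_nonneg _) ?_ (h.continuousHs.2 t ht)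
    filter_upwards [self_mem_nhdsWithin] with τ hτ
    rw [← hf τ hτ, ← hf t ht, ← map_sub]
    exact norm_le_hsNorm_besselPotential s _
  obtain ⟨f', hf'c, hf'0, hf'n, hf'd⟩ := exists_weak_solution (isSelfAdjoint_besselPotential s)
    (injective_besselPotential s) (isPositive_linftyMul hp) (norm_besselPotential_le s) (f 0)
  -- The given solution coincides with the constructed one and so inherits its bound.
  have hzero := weak_solution_unique (isSelfAdjoint_besselPotential s)
    (injective_besselPotential s) (isPositive_linftyMul hp) (norm_besselPotential_le s) hT
    (f := fun τ => f τ - f' τ) (hfc.sub hf'c.continuousOn) (by simp [hf'0]) fun t ht g => by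
      obtain ⟨D, hD, hDeq⟩ := h.equation t ht _ (memHs_besselPotential s g)
      rw [← hf t ht, inner_fracLaplacian_besselPotential, ← linftyMul_apply] at hDeq
      have hD' : HasDerivWithinAt
          (fun τ => ⟪besselPotential s g, besselPotential s (f τ)⟫_ℂ) D (Icc 0 T) t :=
        hD.congr (fun τ hτ => by rw [hf τ hτ]) (by rw [hf t ht])
      simp only [map_sub, inner_sub_right]
      refine (hD'.sub (hf'd t g).hasDerivWithinAt).congr_deriv ?_
      linear_combination (-Complex.I) * hDeq + D * Complex.I_mul_I
  have h1 : f t = f' t := sub_eq_zero.1 (hzero t ht)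
  rw [← h.initial, ← hf 0 hmem0, ← hf t ht, h1, mul_assoc]
  refine (hsNorm_besselPotential_le s _).trans ?_
  gcongr
  refine (hf'n t).trans ?_
  gcongr
  · exact norm_linftyMul_le p
  · exact norm_le_hsNorm_besselPotential s _

/-! ### Very weak solutions -/

lemma hsModerateOn_of_isSolution {p : Eps → Linfty d} {u₀ : Eps → L2 d}
    (hp : ∀ ε, 0 ≤ p ε) (hpm : LinftyModerate p) (hu₀ : HsModerate s u₀) {u : Eps → ℝ → L2 d}
    (hu : ∀ ε, IsSolution s T (p ε) (u₀ ε) (u ε)) : HsModerateOn s T u := by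
  obtain ⟨N, c, hc, hpN⟩ := hpm
  obtain ⟨-, N₀, c₀, hc₀, hu₀N⟩ := hu₀
  refine ⟨fun ε => (hu ε).continuousHs, N + N₀, 2 * (1 + c) * c₀, by positivity,
    fun ε t ht => ((hu ε).hsNorm_le (hp ε) ht).trans ?_⟩
  have hε : (0 : ℝ) < ε := ε.2.1
  -- As `ε ≤ 1`, the summand `1` in `1 + ‖p ε‖` is absorbed into the power.
  have h1 : (1 : ℝ) ≤ (ε : ℝ) ^ (-(N : ℤ)) := by
    rw [zpow_neg, zpow_natCast]
    exact (one_le_inv₀ (pow_pos hε N)).2 (pow_le_one₀ hε.le ε.2.2)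
  have h2 : 1 + ‖p ε‖ ≤ (1 + c) * (ε : ℝ) ^ (-(N : ℤ)) := by
    rw [one_add_mul]
    exact add_le_add h1 (hpN ε)
  calc 2 * (1 + ‖p ε‖) * hsNorm s (u₀ ε)
      ≤ 2 * ((1 + c) * (ε : ℝ) ^ (-(N : ℤ))) * (c₀ * (ε : ℝ) ^ (-(N₀ : ℤ))) := by
        have := hsNorm_nonneg s (u₀ ε)
        gcongr
        exact hu₀N ε
    _ = 2 * (1 + c) * c₀ * (ε : ℝ) ^ (-((N + N₀ : ℕ) : ℤ)) := by
        rw [Nat.cast_add, neg_add, zpow_add₀ hε.ne']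
        ring

lemma exists_isVeryWeakSolutionFor {p : Eps → Linfty d} {u₀ : Eps → L2 d}
    (hp : ∀ ε, 0 ≤ p ε) (hpm : LinftyModerate p) (hu₀ : HsModerate s u₀) :
    ∃ u : Eps → ℝ → L2 d, IsVeryWeakSolutionFor s T p u₀ u := by
  choose u hu using fun ε => exists_isSolution s T (hp ε) (hu₀.1 ε)
  exact ⟨u, hpm, hu₀, hu, hsModerateOn_of_isSolution hp hpm hu₀ hu⟩

/-- Each value of the convolution is `P` applied to a non-negative test function. -/
lemma IsRegularisation.nonneg {P : 𝓓'((⊤ : TopologicalSpace.Opens (Space d)), ℝ)}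
    (hP : DistribNonneg P) {p : Eps → Linfty d} (hp : IsRegularisation P p) (ε : Eps) :
    0 ≤ p ε := by
  obtain ⟨ψ, hψ, h⟩ := hp
  rw [← Lp.coeFn_nonneg]
  filter_upwards [h ε] with x hx
  rw [hx]
  refine hP _ fun y => ?_
  have hε : (0 : ℝ) < ε := ε.2.1
  exact mul_nonneg (by positivity) (hψ.1 _)

end FracSchrodinger

theorem mainTheorem1 (d : ℕ) (s T : ℝ) (hs : 0 < s) (hT : 0 < T) :
    -- arbitrary regularising nets, for a potential and data that need not be distributions
    (∀ (p : FracSchrodinger.Eps → FracSchrodinger.Linfty d)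
        (u₀ : FracSchrodinger.Eps → FracSchrodinger.L2 d),
      (∀ ε, 0 ≤ p ε) →
      FracSchrodinger.LinftyModerate p →
      FracSchrodinger.HsModerate s u₀ →
      (∃ u : FracSchrodinger.Eps → ℝ → FracSchrodinger.L2 d,
        FracSchrodinger.IsVeryWeakSolutionFor s T p u₀ u) ∧
      (∀ u : FracSchrodinger.Eps → ℝ → FracSchrodinger.L2 d,
        (∀ ε, FracSchrodinger.IsSolution s T (p ε) (u₀ ε) (u ε)) →
        FracSchrodinger.HsModerateOn s T u)) ∧
    -- a non-negative distributional potential and distributional data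
    (∀ (P : 𝓓'((⊤ : TopologicalSpace.Opens (FracSchrodinger.Space d)), ℝ))
        (U₀ : 𝓓'((⊤ : TopologicalSpace.Opens (FracSchrodinger.Space d)), ℂ)),
      FracSchrodinger.DistribNonneg P →
      (∃ p : FracSchrodinger.Eps → FracSchrodinger.Linfty d,
        FracSchrodinger.IsRegularisation P p ∧ FracSchrodinger.LinftyModerate p) →
      (∃ u₀ : FracSchrodinger.Eps → FracSchrodinger.L2 d,
        FracSchrodinger.IsRegularisation U₀ u₀ ∧ FracSchrodinger.HsModerate s u₀) →
      ∃ u : FracSchrodinger.Eps → ℝ → FracSchrodinger.L2 d,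
        FracSchrodinger.IsVeryWeakSolution s T P U₀ u) := by
  refine ⟨fun p u₀ hp hpm hu₀ => ⟨FracSchrodinger.exists_isVeryWeakSolutionFor hp hpm hu₀,
    fun u hu => FracSchrodinger.hsModerateOn_of_isSolution hp hpm hu₀ hu⟩, ?_⟩
  rintro P U₀ hP ⟨p, hp, hpm⟩ ⟨u₀, hu₀, hu₀m⟩
  obtain ⟨u, hu⟩ := FracSchrodinger.exists_isVeryWeakSolutionFor (T := T) (hp.nonneg hP) hpm hu₀m
  exact ⟨u, p, u₀, hp, hu₀, hu⟩
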